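/- Let $m,n,k$ be positive integers with $2\le k\le m\le n$, and let $t=m-k$ or $t=m-k+1$. Let $\bar R_{m,n;t}$ be the region obtained from the $m\times n$ rectangle of boxes (rows numbered $1,\dots,m$ from top to bottom, columns $1,\dots,n$ from left to right) by removing the staircase of size $t$ in its lower-right corner, that is, the boxes $(i,j)$ with $(m-i)+(n-j)<t$. A $(0,1)$-filling of a region $R$ assigns $0$ or $1$ to each of its boxes. It contains $I_k$ if there are rows $r_1<\dots<r_k$ and columns $c_1<\dots<c_k$ such that all boxes $(r_i,c_j)$, $1\le i,j\le k$, belong to $R$ and the boxes $(r_1,c_1),\dots,(r_k,c_k)$ are filled with $1$ (the other boxes $(r_i,c_j)$ may contain $0$ or $1$); otherwise it is $I_k$-avoiding. An $I_k$-avoiding filling of $R$ is maximal if it has the largest number of $1$'s among all $I_k$-avoiding fillings of $R$. Then the number of maximal $I_k$-avoiding $(0,1)$-fillings of $\bar R_{m,n;t}$ is $$\prod_{i=1}^{k-1}\frac{(m+n-2k+2i+\delta_{t,m-k})!}{(m-i)!\,(n+i-1+\delta_{t,m-k})!}\cdot\prod_{i=1}^{k-2}i!\cdot\prod_{1\le i\le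 j\le k-1}(n-m+i+j-1+\delta_{t,m-k}),$$ where $\delta_{a,b}$ is the Kronecker delta. -/

import Mathlib

/-- The boxes `(i, j)` of the `m × n` rectangle: `i` is the row, numbered `1, …, m` from top to
bottom, and `j` is the column, numbered `1, …, n` from left to right. -/
def rectangle (m n : ℕ) : Finset (ℕ × ℕ) :=
  Finset.Icc 1 m ×ˢ Finset.Icc 1 n

/-- The staircase of size `t` in the lower right corner of the `m × n` rectangle
(for `t ≤ min m n`): its rows have, from the bottom upwards, the last `t, t - 1, …, 1` boxes. -/
def cornerStaircase (m n t : ℕ) : Finset (ℕ × ℕ) :=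
  (rectangle m n).filter (fun b => (m - b.1) + (n - b.2) < t)

/-- The `m × n` rectangle with the staircase of size `t` removed from its lower right corner. -/
def truncatedRectangle (m n t : ℕ) : Finset (ℕ × ℕ) :=
  rectangle m n \ cornerStaircase m n t

/-- A `(0,1)`-filling of a region `R` made of boxes of the square lattice. -/
abbrev Filling (R : Finset (ℕ × ℕ)) : Type :=
  {b : ℕ × ℕ // b ∈ R} → Fin 2

/-- `F` contains `I_k` (the pattern `12⋯k`): there are rows `r 0 < ⋯ < r (k-1)` and columns
`c 0 < ⋯ < c (k-1)` such that all boxes `(r i, c j)` lie in `R` and the diagonal boxes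
`(r i, c i)` are filled with `1`. -/
def Filling.ContainsId {R : Finset (ℕ × ℕ)} (F : Filling R) (k : ℕ) : Prop :=
  ∃ r c : Fin k → ℕ, StrictMono r ∧ StrictMono c ∧
    ∃ h : ∀ i j : Fin k, (r i, c j) ∈ R, ∀ i : Fin k, F ⟨(r i, c i), h i i⟩ = 1

/-- `F` is `I_k`-avoiding. -/
def Filling.AvoidsId {R : Finset (ℕ × ℕ)} (F : Filling R) (k : ℕ) : Prop :=
  ¬ F.ContainsId k

/-- The number of boxes filled with `1`. -/
def Filling.ones {R : Finset (ℕ × ℕ)} (F : Filling R) : ℕ :=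
  (Finset.univ.filter (fun b => F b = 1)).card

/-- The set of maximal `I_k`-avoiding fillings of `R`: those `I_k`-avoiding fillings that
contain the largest number of `1`s among all `I_k`-avoiding fillings of `R`. -/
def maximalAvoidingFillings (R : Finset (ℕ × ℕ)) (k : ℕ) : Set (Filling R) :=
  {F | F.AvoidsId k ∧ ∀ G : Filling R, G.AvoidsId k → G.ones ≤ F.ones}

/-- The Kronecker delta. -/
def kroneckerDelta (a b : ℕ) : ℕ :=
  if a = b then 1 else 0

/-! Put p = k - 1, m = a + p, n = b + p and a = t + δ. Because the region is closed towards the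
upper left, containing I_k means having a strictly south-east chain of p + 1 ones. A chain-free set
has at most p boxes on a diagonal, and the hook made of the first p rows and p columns attains the
optimum on every diagonal at once; so maximality is a condition on each diagonal separately
(`maximal_iff_card_diagonal`). The diagonals with c - r ≤ -a or c - r ≥ b are then full, and each
one between carries p ones.

Reading the rows on the diagonals b, b - 1, ..., -a as positions of p particles at times 0, ..., a +
b, chain-freeness says that each particle moves by 0 or 1, and the staircase becomes a moving wall
(`exists_isWalk`, `IsWalk.not_hasChain`). These walks are counted by a determinant of ballot
numbers, which obeys the same recurrence, boundary conditions and initial values (`card_walks`). For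
the final position at hand the determinant reduces to a Vandermonde determinant
(`det_ballotMatrix_shifted`), which gives the product. -/

/-! ### Ballot numbers -/

/-- The ballot numbers `C(N, q) - C(N, q - 1)`, extended by `0` to all integers `q`. -/
def ballot : ℕ → ℤ → ℤ
  | 0, q => if q = 0 then 1 else if q = 1 then -1 else 0
  | N + 1, q => ballot N q + ballot N (q - 1)

theorem ballot_of_neg (N : ℕ) : ∀ q : ℤ, q < 0 → ballot N q = 0 := by
  induction N with
  | zero => intro q hq; simp only [ballot]; split_ifs <;> omega
  | succ N ih => intro q hq; rw [ballot, ih q hq, ih (q - 1) (by omega), add_zero]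

theorem ballot_zero (N : ℕ) : ballot N 0 = 1 := by
  induction N with
  | zero => simp [ballot]
  | succ N ih => rw [ballot, ih, ballot_of_neg _ _ (by omega), add_zero]

/-- Reflection principle: the initial value -1 at q = 1 is the mirror image of the 1 at q = 0, and
the recurrence preserves the antisymmetry. It forces zeros on the wall 2q = N + 1. -/
theorem ballot_reflect (N : ℕ) : ∀ q : ℤ, ballot N (N + 1 - q) = -ballot N q := by
  induction N with
  | zero => intro q; simp only [ballot]; push_cast; split_ifs <;> omega
  | succ N ih =>
    intro q
    have h1 := ih q
    have h2 := ih (q - 1)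
    rw [ballot, ballot]
    push_cast
    rw [show (N : ℤ) + 1 + 1 - q = N + 1 - (q - 1) by ring, h2,
      show (N : ℤ) + 1 - (q - 1) - 1 = N + 1 - q by ring, h1]
    ring

theorem ballot_eq_zero_of_wall (N : ℕ) (q : ℤ) (h : 2 * q = N + 1) : ballot N q = 0 := by
  have := ballot_reflect N q
  rw [show (N : ℤ) + 1 - q = q by omega] at this
  omega

theorem ballot_mul_factorial (N : ℕ) : ∀ a b : ℕ, a + b = N + 1 →
    ballot N a * (a.factorial * b.factorial) = ((b : ℤ) - a) * N.factorial := by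
  induction N with
  | zero =>
    intro a b h
    obtain ⟨rfl, rfl⟩ | ⟨rfl, rfl⟩ : (a = 0 ∧ b = 1) ∨ (a = 1 ∧ b = 0) := by omega
    all_goals simp [ballot]
  | succ N ih =>
    intro a b h
    rcases a with _ | a
    · obtain rfl : b = N + 2 := by omega
      rw [Nat.cast_zero, ballot_zero, Nat.factorial_succ (N + 1), Nat.factorial_zero]
      push_cast
      ring
    rcases b with _ | b
    · obtain rfl : a = N + 1 := by omega
      have := ballot_reflect (N + 1) 0
      rw [ballot_zero] at this
      rw [show ((N + 1 + 1 : ℕ) : ℤ) = ((N + 1 : ℕ) : ℤ) + 1 - 0 by push_cast; ring, this,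
        Nat.factorial_succ (N + 1), Nat.factorial_zero]
      push_cast
      ring
    have h1 := ih (a + 1) b (by omega)
    have h2 := ih a (b + 1) (by omega)
    obtain rfl : N = a + b := by omega
    rw [ballot, Nat.factorial_succ (a + b), show (((a + 1 : ℕ) : ℤ) - 1) = a by push_cast; ring]
    rw [Nat.factorial_succ] at h1 h2
    rw [Nat.factorial_succ, Nat.factorial_succ]
    push_cast at h1 h2 ⊢
    linear_combination (b + 1 : ℤ) * h1 + (a + 1 : ℤ) * h2

/-! ### Nonintersecting walks below a moving wall, counted by a determinant -/

/-- The positions of `p` particles that are admissible at time `τ`: they are distinct, listed in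
increasing order, and do not cross a wall that moves by half a unit at each time step. -/
def Admissible (p τ : ℕ) (x : Fin p → ℤ) : Prop :=
  StrictMono x ∧ ∀ i, 2 * x i + 2 ≤ 2 * p + τ

/-- The position `0, 1, …, p - 1`. -/
def packed (p : ℕ) : Fin p → ℤ := fun i => (i : ℕ)

/-- The walks of length `S` of `p` particles from the packed position to `e`, each particle moving
by `0` or `1` at each step, which are admissible at all times (where the clock starts at `δ`).
A walk is constant from time `S` on. -/
structure IsWalk (p δ S : ℕ) (e : Fin p → ℤ) (f : ℕ → Fin p → ℤ) : Prop where
  start : f 0 = packed p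
  admissible : ∀ τ ≤ S, Admissible p (τ + δ) (f τ)
  step : ∀ τ < S, ∀ i, f (τ + 1) i = f τ i ∨ f (τ + 1) i = f τ i + 1
  const : ∀ τ, S ≤ τ → f τ = e

/-- The matrix of ballot numbers whose determinant counts walks. -/
def ballotMatrix (p T : ℕ) (e : Fin p → ℤ) : Matrix (Fin p) (Fin p) ℤ :=
  Matrix.of fun i l => ballot (T + 2 * (p - 1 - (l : ℕ))) (e i - (l : ℕ))

theorem StrictMono.add_le_of_fin {p : ℕ} {x : Fin p → ℤ} (hx : StrictMono x) {i j : Fin p}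
    (h : i ≤ j) : x i + (j : ℕ) ≤ x j + (i : ℕ) := by
  obtain ⟨i, hi⟩ := i
  obtain ⟨j, hj⟩ := j
  obtain ⟨d, rfl⟩ := Nat.exists_eq_add_of_le (show i ≤ j from h)
  induction d with
  | zero => simp
  | succ d ih =>
    have h1 := ih (by omega) (by simp)
    have h2 : x ⟨i + d, by omega⟩ < x ⟨i + (d + 1), hj⟩ := hx (by simp [Fin.lt_def])
    simp only at h1 ⊢
    push_cast at h1 ⊢
    omega

/-- Column l behaves as if its particle had started at position l at time -2(p - 1 - l), touching
the wall. These virtual starts are harmless: only the values of the determinant at the initial time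
matter, and they are found here and in the next lemma. -/
theorem det_ballotMatrix_packed (p T : ℕ) : (ballotMatrix p T (packed p)).det = 1 := by
  rw [Matrix.det_of_isLowerTriangular]
  · refine Finset.prod_eq_one fun i _ => ?_
    simp [ballotMatrix, packed, ballot_zero]
  · intro i j hij
    have : i < j := hij
    simp only [ballotMatrix, packed, Matrix.of_apply]
    exact ballot_of_neg _ _ (by rw [Fin.lt_def] at this; omega)

/-- As δ ≤ 1, the wall and parity keep the last particle at or below p - 1. A strictly increasing
position other than the packed one then has a negative first entry, whose row vanishes. -/
theorem det_ballotMatrix_of_ne_packed (p δ : ℕ) (hδ : δ ≤ 1) (e : Fin p → ℤ)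
    (he : Admissible p δ e) (hne : e ≠ packed p) : (ballotMatrix p δ e).det = 0 := by
  obtain ⟨i, hi⟩ := Function.ne_iff.1 hne
  have hp : 0 < p := i.pos
  have h1 := he.1.add_le_of_fin (i := i) (j := ⟨p - 1, by omega⟩) (by simp [Fin.le_def]; omega)
  have h2 := he.1.add_le_of_fin (i := ⟨0, hp⟩) (j := i) (by simp [Fin.le_def])
  have h3 := he.2 ⟨p - 1, by omega⟩
  simp only [packed] at hi h1 h2
  refine Matrix.det_eq_zero_of_row_eq_zero ⟨0, hp⟩ fun l => ?_
  exact ballot_of_neg _ _ (by push_cast at h1 h2 ⊢; omega)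

theorem ballotMatrix_succ (p T : ℕ) (e : Fin p → ℤ) :
    ballotMatrix p (T + 1) e = ballotMatrix p T e + ballotMatrix p T (e - 1) := by
  ext i l
  simp only [ballotMatrix, Matrix.of_apply, Matrix.add_apply, Pi.sub_apply, Pi.one_apply]
  rw [show T + 1 + 2 * (p - 1 - (l : ℕ)) = T + 2 * (p - 1 - (l : ℕ)) + 1 by ring, ballot]
  congr 2
  ring

/-- Pascal's rule in each row, expanded by multilinearity; `s` is the set of particles that stay in
place during the last step. -/
theorem det_ballotMatrix_succ (p T : ℕ) (e : Fin p → ℤ) :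
    (ballotMatrix p (T + 1) e).det =
      ∑ s : Finset (Fin p), (ballotMatrix p T (s.piecewise e (e - 1))).det := by
  rw [ballotMatrix_succ]
  have := (Matrix.detRowAlternating (n := Fin p) (R := ℤ)).toMultilinearMap.map_add_univ
    (ballotMatrix p T e) (ballotMatrix p T (e - 1))
  refine this.trans (Finset.sum_congr rfl fun s _ => ?_)
  change Matrix.det _ = _
  congr 1
  ext i l
  by_cases h : i ∈ s <;> simp [Finset.piecewise, ballotMatrix, h]

/-- From an admissible position, one step back can fail only by a collision, which gives two equal
rows, or by lying just beyond the wall, which gives a row of ballot numbers with 2q = N + 1. -/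
theorem det_ballotMatrix_of_not_admissible (p T : ℕ) (e : Fin p → ℤ)
    (he : Admissible p (T + 1) e) (s : Finset (Fin p))
    (hs : ¬ Admissible p T (s.piecewise e (e - 1))) :
    (ballotMatrix p T (s.piecewise e (e - 1))).det = 0 := by
  set x := s.piecewise e (e - 1) with hx
  have hv : ∀ i, x i = e i ∨ x i = e i - 1 := fun i => by
    by_cases h : i ∈ s <;> simp [hx, h]
  by_cases hm : StrictMono x
  · obtain ⟨i, hi⟩ : ∃ i, ¬ (2 * x i + 2 ≤ 2 * p + T) := by
      by_contra! h
      exact hs ⟨hm, h⟩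
    have h1 := he.2 i
    push_cast at h1
    refine Matrix.det_eq_zero_of_row_eq_zero i fun l => ballot_eq_zero_of_wall _ _ ?_
    have := hv i
    have := l.2
    push_cast
    omega
  · obtain ⟨i, j, hij, hle⟩ : ∃ i j, i < j ∧ x j ≤ x i := by
      by_contra! h
      exact hm fun i j hij => h i j hij
    have h1 := he.1 hij
    have h2 : x i = x j := by have := hv i; have := hv j; omega
    refine Matrix.det_zero_of_row_eq hij.ne ?_
    ext l
    simp [ballotMatrix, h2]

open Classical in
/-- The walks of length `S` ending at `e`, constructed from the walks of length `S - 1`. -/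
noncomputable def walks (p δ : ℕ) : ℕ → (Fin p → ℤ) → Finset (ℕ → Fin p → ℤ)
  | 0, e => if e = packed p then {fun _ => e} else ∅
  | S + 1, e => ((Finset.univ : Finset (Finset (Fin p))).filter
      fun s => Admissible p (S + δ) (s.piecewise e (e - 1))).biUnion fun s =>
        (walks p δ S (s.piecewise e (e - 1))).image fun f τ => if τ ≤ S then f τ else e

/-- The recursion tests only the positions before the last, so admissibility of `e` itself has to be
assumed. -/
theorem mem_walks (p δ S : ℕ) : ∀ (e : Fin p → ℤ) (_ : Admissible p (S + δ) e)
    (f : ℕ → Fin p → ℤ), f ∈ walks p δ S e ↔ IsWalk p δ S e f := by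
  induction S with
  | zero =>
    intro e he f
    constructor
    · intro h
      rw [walks] at h
      split_ifs at h with h0
      · obtain rfl := Finset.mem_singleton.1 h
        exact ⟨h0, fun τ hτ => by simpa [Nat.le_zero.1 hτ] using he, fun τ hτ => by omega,
          fun _ _ => rfl⟩
      · simp at h
    · intro h
      have h0 : e = packed p := (h.const 0 le_rfl).symm.trans h.start
      rw [walks, if_pos h0, Finset.mem_singleton]
      exact funext fun τ => h.const τ (Nat.zero_le _)
  | succ S ih =>
    intro e he f
    simp only [walks, Finset.mem_biUnion, Finset.mem_filter, Finset.mem_univ, true_and,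
      Finset.mem_image]
    constructor
    · rintro ⟨s, hs, g, hg, rfl⟩
      rw [ih _ hs] at hg
      refine ⟨by simpa using hg.start, fun τ hτ => ?_, fun τ hτ i => ?_, fun τ hτ => ?_⟩
      · split_ifs with h
        · exact hg.admissible τ h
        · obtain rfl : τ = S + 1 := by omega
          exact he
      · rcases Nat.lt_or_ge τ S with h | h
        · rw [if_pos (by omega), if_pos (by omega)]
          exact hg.step τ h i
        · obtain rfl : τ = S := by omega
          rw [if_neg (by omega), if_pos le_rfl, hg.const τ le_rfl]
          by_cases h : i ∈ s <;> simp [Finset.piecewise, h]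
      · rw [if_neg (by omega)]
    · intro h
      classical
      have hlast := h.const (S + 1) le_rfl
      have hpw : (Finset.univ.filter fun i => f (S + 1) i = f S i).piecewise e (e - 1) = f S := by
        ext i
        have := h.step S (Nat.lt_succ_self S) i
        by_cases hi : f (S + 1) i = f S i
        · simp [Finset.piecewise, hi, ← hlast]
        · simp only [Finset.piecewise, Finset.mem_filter, Finset.mem_univ, true_and, hi, if_false,
            ← hlast, Pi.sub_apply, Pi.one_apply]
          omega
      refine ⟨Finset.univ.filter fun i => f (S + 1) i = f S i, ?_,
        fun τ => if τ ≤ S then f τ else f S, ?_, ?_⟩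
      · rw [hpw]; exact h.admissible S (Nat.le_succ S)
      · rw [hpw, ih _ (h.admissible S (Nat.le_succ S))]
        refine ⟨by simpa using h.start, fun τ hτ => ?_, fun τ hτ i => ?_, fun τ hτ => ?_⟩
        · simpa [hτ] using h.admissible τ (by omega)
        · rw [if_pos (by omega), if_pos (by omega)]
          exact h.step τ (by omega) i
        · split_ifs with h'
          · obtain rfl : τ = S := by omega
            rfl
          · rfl
      · funext τ
        by_cases h' : τ ≤ S
        · simp [h']
        · simp only [h', if_false]
          exact (h.const τ (by omega)).symm

theorem card_walks (p δ : ℕ) (hδ : δ ≤ 1) (S : ℕ) : ∀ e : Fin p → ℤ, Admissible p (S + δ) e →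
    ((walks p δ S e).card : ℤ) = (ballotMatrix p (S + δ) e).det := by
  classical
  induction S with
  | zero =>
    intro e he
    rw [zero_add] at he ⊢
    rw [walks]
    split_ifs with h
    · rw [h, det_ballotMatrix_packed]; simp
    · rw [det_ballotMatrix_of_ne_packed p δ hδ e he h]; simp
  | succ S ih =>
    intro e he
    rw [show S + 1 + δ = S + δ + 1 by ring] at he ⊢
    rw [det_ballotMatrix_succ, walks, Finset.card_biUnion, Nat.cast_sum, Finset.sum_filter]
    · refine Finset.sum_congr rfl fun s _ => ?_
      split_ifs with hs
      · rw [Finset.card_image_of_injOn, ih _ hs]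
        intro f hf g hg hfg
        rw [Finset.mem_coe, mem_walks _ _ _ _ hs] at hf hg
        funext τ
        rcases le_total τ S with h | h
        · simpa [h] using congrFun hfg τ
        · rw [hf.const τ h, hg.const τ h]
      · exact (det_ballotMatrix_of_not_admissible p _ e he s hs).symm
    · intro s hs s' hs' hne
      rw [Function.onFun, Finset.disjoint_left]
      rintro f hf hf'
      obtain ⟨g, hg, rfl⟩ := Finset.mem_image.1 hf
      obtain ⟨g', hg', heq⟩ := Finset.mem_image.1 hf'
      rw [mem_walks _ _ _ _ (Finset.mem_filter.1 hs).2] at hg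
      rw [mem_walks _ _ _ _ (Finset.mem_filter.1 hs').2] at hg'
      have h := congrFun heq S
      simp only [le_refl, if_true, hg.const S le_rfl, hg'.const S le_rfl] at h
      -- The position at time `S` determines which particles stay in the last step, so different `s`
      -- give disjoint sets of walks.
      refine hne (Finset.ext fun i => ?_)
      have := congrFun h i
      by_cases h1 : i ∈ s <;> by_cases h2 : i ∈ s' <;>
        simp [Finset.piecewise, h1, h2] at this ⊢
      omega

/-! ### Evaluation of the determinant -/

/-- Splits an entry into a row factor, a column factor and a product of falling factorials. For x <
l both sides vanish. -/
theorem ballot_eq_descFactorial (x y l N : ℕ) (hl : l ≤ y) (h : x + y = N + 1 + 2 * l) :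
    (ballot N ((x : ℤ) - l) : ℚ) =
      ((y : ℚ) - x) / (x.factorial * y.factorial) *
        (N.factorial * ((x.descFactorial l : ℚ) * y.descFactorial l)) := by
  rcases Nat.lt_or_ge x l with hx | hx
  · rw [ballot_of_neg _ _ (by omega), Nat.descFactorial_of_lt hx]
    simp
  · obtain ⟨a, rfl⟩ := Nat.exists_eq_add_of_le' hx
    obtain ⟨b, rfl⟩ := Nat.exists_eq_add_of_le' hl
    have h1 := ballot_mul_factorial N a b (by omega)
    have h2 := Nat.factorial_mul_descFactorial (Nat.le_add_left l a)
    have h3 := Nat.factorial_mul_descFactorial (Nat.le_add_left l b)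
    rw [Nat.add_sub_cancel] at h2 h3
    have ha : ((a + l).descFactorial l : ℚ) ≠ 0 := by
      exact_mod_cast (Nat.descFactorial_pos.2 (Nat.le_add_left l a)).ne'
    have hb : ((b + l).descFactorial l : ℚ) ≠ 0 := by
      exact_mod_cast (Nat.descFactorial_pos.2 (Nat.le_add_left l b)).ne'
    have ha' : (a.factorial : ℚ) ≠ 0 := by exact_mod_cast a.factorial_ne_zero
    have hb' : (b.factorial : ℚ) ≠ 0 := by exact_mod_cast b.factorial_ne_zero
    rw [← h2, ← h3, show (((a + l : ℕ) : ℤ) - l) = a by push_cast; ring]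
    have h1' : (ballot N a : ℚ) * (a.factorial * b.factorial) = ((b : ℚ) - a) * N.factorial := by
      exact_mod_cast h1
    push_cast
    field_simp
    linear_combination h1'

open Polynomial in
/-- The polynomial in `z = x * y` that equals `x.descFactorial l * y.descFactorial l` when
`x + y = c`. -/
noncomputable def descPairPolynomial (c : ℚ) (l : ℕ) : ℚ[X] :=
  ∏ u ∈ Finset.range l, (X - C ((u : ℚ) * (c - u)))

theorem monic_descPairPolynomial (c : ℚ) (l : ℕ) : (descPairPolynomial c l).Monic :=
  Polynomial.monic_prod_X_sub_C _ _

theorem natDegree_descPairPolynomial (c : ℚ) (l : ℕ) : (descPairPolynomial c l).natDegree = l := by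
  rw [descPairPolynomial, Polynomial.natDegree_finsetProd_X_sub_C_eq_card, Finset.card_range]

/-- With c = x + y, each factor is (x - u)(y - u) = xy - u(c - u). -/
theorem eval_descPairPolynomial (x y l : ℕ) :
    (descPairPolynomial ((x : ℚ) + y) l).eval ((x : ℚ) * y) =
      (x.descFactorial l : ℚ) * y.descFactorial l := by
  have key : ∀ z : ℕ, (z.descFactorial l : ℚ) = ∏ u ∈ Finset.range l, ((z : ℚ) - u) := by
    intro z
    rw [← descPochhammer_eval_eq_descFactorial, descPochhammer_eval_eq_prod_range]
  rw [descPairPolynomial, Polynomial.eval_prod, key, key, ← Finset.prod_mul_distrib]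
  refine Finset.prod_congr rfl fun u _ => ?_
  simp only [Polynomial.eval_sub, Polynomial.eval_X, Polynomial.eval_C]
  ring

/-- In row i take x = i + a and y = b + 2p - 1 - i, whose sum does not depend on i. After row and
column factors are removed, column l is a monic polynomial of degree l in z = xy, so a Vandermonde
determinant in the z's remains. -/
theorem det_ballotMatrix_shifted (p a b : ℕ) :
    ((ballotMatrix p (a + b) fun i => ((i : ℕ) : ℤ) + a).det : ℚ) =
      (∏ i : Fin p, ((b : ℚ) - a + 2 * p - 1 - 2 * (i : ℕ)) /
        (((i : ℕ) + a).factorial * (b + 2 * p - 1 - (i : ℕ)).factorial)) *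
      ((∏ l : Fin p, ((a + b + 2 * (p - 1 - (l : ℕ))).factorial : ℚ)) *
      ∏ i : Fin p, ∏ j ∈ Finset.Ioi i,
        (((j : ℕ) : ℚ) - (i : ℕ)) * ((b : ℚ) - a + 2 * p - 1 - (i : ℕ) - (j : ℕ))) := by
  have hsub : ∀ i : Fin p, ((b + 2 * p - 1 - (i : ℕ) : ℕ) : ℚ) = (b : ℚ) + 2 * p - 1 - (i : ℕ) := by
    intro i
    have := i.2
    rw [Nat.cast_sub (by omega), Nat.cast_sub (by omega)]
    push_cast
    ring
  have hV := Matrix.det_eval_matrixOfPolynomials_eq_det_vandermonde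
    (fun i : Fin p => (((i : ℕ) + a : ℕ) : ℚ) * ((b + 2 * p - 1 - (i : ℕ) : ℕ) : ℚ))
    (fun l : Fin p => descPairPolynomial ((a : ℚ) + b + 2 * p - 1) l)
    (fun l => natDegree_descPairPolynomial _ _) (fun l => monic_descPairPolynomial _ _)
  rw [Matrix.det_vandermonde] at hV
  have hz : ∏ i : Fin p, ∏ j ∈ Finset.Ioi i,
        (((j : ℕ) : ℚ) - (i : ℕ)) * ((b : ℚ) - a + 2 * p - 1 - (i : ℕ) - (j : ℕ)) =
      ∏ i : Fin p, ∏ j ∈ Finset.Ioi i,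
        ((((j : ℕ) + a : ℕ) : ℚ) * ((b + 2 * p - 1 - (j : ℕ) : ℕ) : ℚ) -
          (((i : ℕ) + a : ℕ) : ℚ) * ((b + 2 * p - 1 - (i : ℕ) : ℕ) : ℚ)) := by
    refine Finset.prod_congr rfl fun i _ => Finset.prod_congr rfl fun j _ => ?_
    rw [hsub, hsub]
    push_cast
    ring
  rw [hz, hV, ← Matrix.det_mul_row, ← Matrix.det_mul_column, Int.cast_det]
  congr 1
  ext i l
  have hi := i.2
  have hl := l.2
  simp only [ballotMatrix, Matrix.map_apply, Matrix.of_apply]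
  have h := ballot_eq_descFactorial ((i : ℕ) + a) (b + 2 * p - 1 - (i : ℕ)) l
    (a + b + 2 * (p - 1 - (l : ℕ))) (by omega) (by omega)
  rw [← eval_descPairPolynomial] at h
  push_cast at h
  push_cast
  rw [h, hsub]
  congr 2
  · ring
  · congr 3
    ring

theorem prod_fin_reflect (p : ℕ) (g : ℕ → ℚ) :
    ∏ i : Fin p, g (p - (i : ℕ)) = ∏ i ∈ Finset.Icc 1 p, g i := by
  refine Finset.prod_bij (fun i _ => p - (i : ℕ)) ?_ ?_ ?_ ?_
  · intro i _; have := i.2; rw [Finset.mem_Icc]; omega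
  · intro i _ j _ h; have := i.2; have := j.2; ext; omega
  · intro j hj
    rw [Finset.mem_Icc] at hj
    exact ⟨⟨p - j, by omega⟩, Finset.mem_univ _, by simp; omega⟩
  · intros; rfl

theorem prod_Ici_reflect (p : ℕ) (g : ℕ → ℕ → ℚ) :
    ∏ i : Fin p, ∏ j ∈ Finset.Ici i, g (p - (j : ℕ)) (p - (i : ℕ)) =
      ∏ i ∈ Finset.Icc 1 p, ∏ j ∈ Finset.Icc i p, g i j := by
  rw [Finset.prod_sigma', Finset.prod_sigma']
  refine Finset.prod_bij (fun x _ => ⟨p - (x.2 : ℕ), p - (x.1 : ℕ)⟩) ?_ ?_ ?_ ?_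
  · rintro ⟨i, j⟩ h
    have := i.2; have := j.2
    simp only [Finset.mem_sigma, Finset.mem_Ici, Fin.le_def, Finset.mem_Icc] at h ⊢
    omega
  · rintro ⟨i, j⟩ _ ⟨i', j'⟩ _ h
    have := i.2; have := j.2; have := i'.2; have := j'.2
    simp only [Sigma.mk.injEq, heq_eq_eq] at h ⊢
    exact ⟨Fin.ext (by omega), Fin.ext (by omega)⟩
  · rintro ⟨i, j⟩ h
    simp only [Finset.mem_sigma, Finset.mem_Icc] at h
    refine ⟨⟨⟨p - j, by omega⟩, ⟨p - i, by omega⟩⟩, ?_, ?_⟩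
    · simp only [Finset.mem_sigma, Finset.mem_univ, Finset.mem_Ici, Fin.le_def, true_and]
      omega
    · simp only [Sigma.mk.injEq, heq_eq_eq]
      omega
  · intros; rfl

theorem prod_Ioi_sub_eq_prod_factorial (p : ℕ) :
    ∏ i : Fin p, ∏ j ∈ Finset.Ioi i, (((j : ℕ) : ℚ) - (i : ℕ)) =
      ∏ i ∈ Finset.Icc 1 (p - 1), (i.factorial : ℚ) := by
  rcases p with _ | p
  · simp
  · rw [← Matrix.det_vandermonde (fun i : Fin (p + 1) => ((i : ℕ) : ℚ)),
      Matrix.det_vandermonde_id_eq_superFactorial, Nat.add_sub_cancel, ← Nat.prod_Icc_factorial]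
    push_cast
    rfl

theorem det_ballotMatrix_shifted_eq_prod (p a b : ℕ) :
    ((ballotMatrix p (a + b) fun i => ((i : ℕ) : ℤ) + a).det : ℚ) =
      (∏ i ∈ Finset.Icc 1 p, ((a + b + 2 * i - 2).factorial : ℚ) /
        ((a + p - i).factorial * (b + p + i - 1).factorial)) *
      (∏ i ∈ Finset.Icc 1 (p - 1), (i.factorial : ℚ)) *
      ∏ i ∈ Finset.Icc 1 p, ∏ j ∈ Finset.Icc i p, ((b : ℚ) - a + i + j - 1) := by
  -- The row factors y - x are exactly the missing terms j = i of the double product.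
  have h1 : ∏ i : Fin p, ∏ j ∈ Finset.Ici i, ((b : ℚ) - a + 2 * p - 1 - (i : ℕ) - (j : ℕ)) =
      (∏ i : Fin p, ((b : ℚ) - a + 2 * p - 1 - 2 * (i : ℕ))) *
      ∏ i : Fin p, ∏ j ∈ Finset.Ioi i, ((b : ℚ) - a + 2 * p - 1 - (i : ℕ) - (j : ℕ)) := by
    rw [← Finset.prod_mul_distrib]
    refine Finset.prod_congr rfl fun i _ => ?_
    rw [← Finset.Ioi_insert, Finset.prod_insert (by simp)]
    congr 1
    ring
  rw [det_ballotMatrix_shifted, ← prod_Ioi_sub_eq_prod_factorial, ← prod_Ici_reflect p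
    fun i j => (b : ℚ) - a + i + j - 1, ← prod_fin_reflect p fun i =>
      ((a + b + 2 * i - 2).factorial : ℚ) / ((a + p - i).factorial * (b + p + i - 1).factorial)]
  have h2 : ∏ i : Fin p, ∏ j ∈ Finset.Ici i,
      ((b : ℚ) - a + ((p - (j : ℕ) : ℕ) : ℚ) + ((p - (i : ℕ) : ℕ) : ℚ) - 1) =
      ∏ i : Fin p, ∏ j ∈ Finset.Ici i, ((b : ℚ) - a + 2 * p - 1 - (i : ℕ) - (j : ℕ)) := by
    refine Finset.prod_congr rfl fun i _ => Finset.prod_congr rfl fun j _ => ?_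
    rw [Nat.cast_sub i.2.le, Nat.cast_sub j.2.le]
    ring
  rw [h2, h1]
  simp only [Finset.prod_mul_distrib, Finset.prod_div_distrib]
  have h3 : ∀ i : Fin p, a + b + 2 * (p - (i : ℕ)) - 2 = a + b + 2 * (p - 1 - (i : ℕ)) :=
    fun i => by have := i.2; omega
  have h4 : ∀ i : Fin p, a + p - (p - (i : ℕ)) = (i : ℕ) + a := fun i => by have := i.2; omega
  have h5 : ∀ i : Fin p, b + p + (p - (i : ℕ)) - 1 = b + 2 * p - 1 - (i : ℕ) :=
    fun i => by have := i.2; omega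
  simp only [h3, h4, h5]
  ring

/-! ### Chains, diagonals and the extremal hook -/

/-- `A` contains `k` boxes each of which lies strictly below and strictly to the right of the
preceding one. -/
def HasChain (A : Finset (ℕ × ℕ)) (k : ℕ) : Prop :=
  ∃ u : Fin k → ℕ × ℕ, StrictMono (fun i => (u i).1) ∧ StrictMono (fun i => (u i).2) ∧
    ∀ i, u i ∈ A

/-- The boxes `(r, c)` of `A` with `c - r = d`. -/
def diagonal (A : Finset (ℕ × ℕ)) (d : ℤ) : Finset (ℕ × ℕ) :=
  A.filter fun q => (q.2 : ℤ) - q.1 = d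

/-- The first `p` rows and the first `p` columns of the `m × n` rectangle. -/
def hook (m n p : ℕ) : Finset (ℕ × ℕ) :=
  (rectangle m n).filter fun q => q.1 ≤ p ∨ q.2 ≤ p

theorem mem_diagonal {A : Finset (ℕ × ℕ)} {d : ℤ} {q : ℕ × ℕ} :
    q ∈ diagonal A d ↔ q ∈ A ∧ (q.2 : ℤ) - q.1 = d := by
  simp [diagonal]

theorem mem_truncatedRectangle {m n t : ℕ} {q : ℕ × ℕ} :
    q ∈ truncatedRectangle m n t ↔
      1 ≤ q.1 ∧ q.1 ≤ m ∧ 1 ≤ q.2 ∧ q.2 ≤ n ∧ q.1 + q.2 + t ≤ m + n := by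
  simp only [truncatedRectangle, cornerStaircase, rectangle, Finset.mem_sdiff, Finset.mem_filter,
    Finset.mem_product, Finset.mem_Icc]
  omega

theorem mem_hook {m n p : ℕ} {q : ℕ × ℕ} :
    q ∈ hook m n p ↔ 1 ≤ q.1 ∧ q.1 ≤ m ∧ 1 ≤ q.2 ∧ q.2 ≤ n ∧ (q.1 ≤ p ∨ q.2 ≤ p) := by
  simp only [hook, rectangle, Finset.mem_filter, Finset.mem_product, Finset.mem_Icc]
  omega

theorem StrictMono.add_le_of_fin_nat {p : ℕ} {x : Fin p → ℕ} (hx : StrictMono x) {i j : Fin p}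
    (h : i ≤ j) : x i + (j : ℕ) ≤ x j + (i : ℕ) := by
  have : StrictMono fun i => (x i : ℤ) := fun i j hij => Int.ofNat_lt.2 (hx hij)
  exact_mod_cast this.add_le_of_fin h

theorem strictMono_splice {α : Type*} (π : α → ℕ) {p : ℕ} {x y : Fin p → α}
    (hx : StrictMono fun i => π (x i)) (hy : StrictMono fun i => π (y i)) (i : Fin p)
    (h : π (x i) < π (y i)) :
    StrictMono fun j : Fin (p + 1) =>
      π (if hj : (j : ℕ) ≤ i then x ⟨j, by omega⟩ else y ⟨j - 1, by omega⟩) := by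
  intro j j' hjj
  have hjj' : (j : ℕ) < j' := hjj
  dsimp only
  split_ifs with h1 h2 h2
  · exact hx hjj'
  · calc π (x ⟨j, _⟩) ≤ π (x i) := hx.monotone (show (j : ℕ) ≤ i from h1)
      _ < π (y i) := h
      _ ≤ _ := hy.monotone (show (i : ℕ) ≤ j' - 1 by omega)
  · omega
  · exact hy (show (j : ℕ) - 1 < j' - 1 by omega)

/-- Follow `u` through index i, then `v` from index i on: this uses (i + 1) + (p - i) = p + 1 boxes.
-/
theorem hasChain_splice {p : ℕ} {A : Finset (ℕ × ℕ)} {u v : Fin p → ℕ × ℕ}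
    (hu₁ : StrictMono fun i => (u i).1) (hu₂ : StrictMono fun i => (u i).2)
    (hv₁ : StrictMono fun i => (v i).1) (hv₂ : StrictMono fun i => (v i).2)
    (hu : ∀ i, u i ∈ A) (hv : ∀ i, v i ∈ A) (i : Fin p) (h₁ : (u i).1 < (v i).1)
    (h₂ : (u i).2 < (v i).2) : HasChain A (p + 1) := by
  refine ⟨fun j => if hj : (j : ℕ) ≤ i then u ⟨j, by omega⟩ else v ⟨j - 1, by omega⟩, 
    strictMono_splice Prod.fst hu₁ hv₁ i h₁, strictMono_splice Prod.snd hu₂ hv₂ i h₂, fun j => ?_⟩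
  dsimp only
  split_ifs
  · exact hu _
  · exact hv _

theorem card_diagonal_le {p : ℕ} {A : Finset (ℕ × ℕ)} (hA : ¬ HasChain A (p + 1)) (d : ℤ) :
    (diagonal A d).card ≤ p := by
  by_contra! hlt
  apply hA
  have hcard : ((diagonal A d).image Prod.fst).card = (diagonal A d).card := by
    refine Finset.card_image_of_injOn fun q hq q' hq' h => ?_
    rw [Finset.mem_coe, mem_diagonal] at hq hq'
    exact Prod.ext h (by omega)
  have hmem := fun i => Finset.orderEmbOfCardLe_mem ((diagonal A d).image Prod.fst)
    (show p + 1 ≤ _ by omega) i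
  set e := Finset.orderEmbOfCardLe ((diagonal A d).image Prod.fst) (show p + 1 ≤ _ by omega)
  simp only [Finset.mem_image, mem_diagonal] at hmem
  choose u hu hu' using hmem
  refine ⟨u, fun i j hij => ?_, fun i j hij => ?_, fun i => (hu i).1⟩
  · simp only [hu']
    exact e.strictMono hij
  · have h1 := e.strictMono hij
    have h2 := (hu i).2
    have h3 := (hu j).2
    have h4 := hu' i
    have h5 := hu' j
    dsimp only
    omega

theorem not_hasChain_hook (m n p : ℕ) : ¬ HasChain (hook m n p) (p + 1) := by
  rintro ⟨u, h1, h2, hu⟩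
  have h3 := h1.add_le_of_fin_nat (Fin.zero_le (Fin.last p))
  have h4 := h2.add_le_of_fin_nat (Fin.zero_le (Fin.last p))
  have h5 := mem_hook.1 (hu 0)
  have h6 := mem_hook.1 (hu (Fin.last p))
  simp only [Fin.val_last, Fin.val_zero] at h3 h4
  omega

theorem hook_subset_truncatedRectangle {m n p t : ℕ} (hm : t + p ≤ m) (hn : t + p ≤ n) :
    hook m n p ⊆ truncatedRectangle m n t := by
  intro q hq
  rw [mem_hook] at hq
  rw [mem_truncatedRectangle]
  omega

theorem card_diagonal_le_hook {m n p t : ℕ} {A : Finset (ℕ × ℕ)}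
    (hAR : A ⊆ truncatedRectangle m n t) (hA : ¬ HasChain A (p + 1)) (d : ℤ) :
    (diagonal A d).card ≤ (diagonal (hook m n p) d).card := by
  by_cases hsub : diagonal A d ⊆ diagonal (hook m n p) d
  · exact Finset.card_le_card hsub
  obtain ⟨q, hq, hqH⟩ := Finset.not_subset.1 hsub
  rw [mem_diagonal] at hq hqH
  have hqR := mem_truncatedRectangle.1 (hAR hq.1)
  rw [mem_hook] at hqH
  refine (card_diagonal_le hA d).trans ?_
  -- A box `q` outside the hook has both coordinates above p, so its diagonal starts with p hook
  -- boxes at the upper or left border.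
  have := Finset.card_le_card_of_injOn (s := Finset.range p) (t := diagonal (hook m n p) d)
    (fun i => (q.1 - min q.1 q.2 + 1 + i, q.2 - min q.1 q.2 + 1 + i)) ?_ ?_
  · simpa using this
  · intro i hi
    rw [Finset.mem_coe, Finset.mem_range] at hi
    rw [Finset.mem_coe, mem_diagonal, mem_hook]
    dsimp only
    omega
  · intro i _ j _ h
    simp only [Prod.mk.injEq] at h
    omega

theorem card_eq_sum_card_diagonal {m n t : ℕ} {A : Finset (ℕ × ℕ)}
    (hAR : A ⊆ truncatedRectangle m n t) :
    A.card = ∑ d ∈ Finset.Icc (-(m : ℤ)) n, (diagonal A d).card := by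
  refine Finset.card_eq_sum_card_fiberwise (f := fun q : ℕ × ℕ => (q.2 : ℤ) - q.1) fun q hq => ?_
  have := mem_truncatedRectangle.1 (hAR hq)
  rw [Finset.mem_coe, Finset.mem_Icc]
  dsimp only
  omega

/-- A set of boxes without chains of length `p + 1` is of maximal size iff it has as many boxes as
the hook on each diagonal. -/
theorem maximal_iff_card_diagonal {m n p t : ℕ} (hm : t + p ≤ m) (hn : t + p ≤ n)
    {A : Finset (ℕ × ℕ)} (hAR : A ⊆ truncatedRectangle m n t) (hA : ¬ HasChain A (p + 1)) :
    (∀ B ⊆ truncatedRectangle m n t, ¬ HasChain B (p + 1) → B.card ≤ A.card) ↔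
      ∀ d, (diagonal A d).card = (diagonal (hook m n p) d).card := by
  have hH := hook_subset_truncatedRectangle hm hn
  constructor
  · intro h d
    have h1 := h _ hH (not_hasChain_hook m n p)
    rw [card_eq_sum_card_diagonal hAR, card_eq_sum_card_diagonal hH] at h1
    have h2 := fun d (_ : d ∈ Finset.Icc (-(m : ℤ)) n) => card_diagonal_le_hook hAR hA d
    by_cases hd : d ∈ Finset.Icc (-(m : ℤ)) n
    · exact (Finset.sum_eq_sum_iff_of_le h2).1 (le_antisymm (Finset.sum_le_sum h2) h1) d hd
    · have : ∀ B ⊆ truncatedRectangle m n t, diagonal B d = ∅ := by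
        intro B hB
        refine Finset.eq_empty_of_forall_notMem fun q hq => hd ?_
        rw [mem_diagonal] at hq
        have := mem_truncatedRectangle.1 (hB hq.1)
        rw [Finset.mem_Icc]
        omega
      rw [this _ hAR, this _ hH]
  · intro h B hBR hB
    rw [card_eq_sum_card_diagonal hAR, card_eq_sum_card_diagonal hBR]
    refine Finset.sum_le_sum fun d _ => ?_
    rw [h]
    exact card_diagonal_le_hook hBR hB d

theorem card_diagonal_hook {a b p : ℕ} {d : ℤ} (h₁ : -(a : ℤ) ≤ d) (h₂ : d ≤ b) :
    (diagonal (hook (a + p) (b + p) p) d).card = p := by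
  refine le_antisymm (card_diagonal_le (not_hasChain_hook _ _ _) d) ?_
  have := Finset.card_le_card_of_injOn (s := Finset.range p)
    (t := diagonal (hook (a + p) (b + p) p) d)
    (fun i => (i + 1 + (-d).toNat, i + 1 + d.toNat)) ?_ ?_
  · simpa using this
  · intro i hi
    rw [Finset.mem_coe, Finset.mem_range] at hi
    rw [Finset.mem_coe, mem_diagonal, mem_hook]
    dsimp only
    omega
  · intro i _ j _ h
    simp only [Prod.mk.injEq] at h
    omega

theorem diagonal_subset_hook {a b p t : ℕ} {d : ℤ} (h : d ≤ -(a : ℤ) ∨ b ≤ d) :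
    diagonal (truncatedRectangle (a + p) (b + p) t) d ⊆ diagonal (hook (a + p) (b + p) p) d := by
  intro q hq
  rw [mem_diagonal, mem_truncatedRectangle] at hq
  rw [mem_diagonal, mem_hook]
  omega

/-! ### Maximal sets of boxes as walks -/

/-- The final position of the walks that encode maximal fillings. -/
def shifted (p a : ℕ) : Fin p → ℤ := fun i => ((i : ℕ) : ℤ) + a

open Classical in
/-- The set of boxes described by a walk: the rows of its boxes on the diagonal `b - τ` are given
by the position at time `τ`, and all outer diagonals are full. -/
noncomputable def boxesOfWalk (p a b t : ℕ) (f : ℕ → Fin p → ℤ) : Finset (ℕ × ℕ) :=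
  (truncatedRectangle (a + p) (b + p) t).filter fun q =>
    (q.2 : ℤ) - q.1 ≤ -a ∨ (b : ℤ) ≤ (q.2 : ℤ) - q.1 ∨
      ∃ i, f ((b : ℤ) - ((q.2 : ℤ) - q.1)).toNat i = (q.1 : ℤ) - 1

theorem mem_boxesOfWalk {p a b t : ℕ} {f : ℕ → Fin p → ℤ} {q : ℕ × ℕ} :
    q ∈ boxesOfWalk p a b t f ↔ q ∈ truncatedRectangle (a + p) (b + p) t ∧
      ((q.2 : ℤ) - q.1 ≤ -a ∨ (b : ℤ) ≤ (q.2 : ℤ) - q.1 ∨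
        ∃ i, f ((b : ℤ) - ((q.2 : ℤ) - q.1)).toNat i = (q.1 : ℤ) - 1) := by
  simp [boxesOfWalk]

theorem IsWalk.le_and_le {p δ S : ℕ} {e : Fin p → ℤ} {f : ℕ → Fin p → ℤ} (h : IsWalk p δ S e f)
    {τ τ' : ℕ} (hτ : τ ≤ τ') (i : Fin p) : f τ i ≤ f τ' i ∧ f τ' i + τ ≤ f τ i + τ' := by
  induction τ', hτ using Nat.le_induction with
  | base => simp
  | succ τ' hτ' ih =>
    have : f (τ' + 1) i = f τ' i ∨ f (τ' + 1) i = f τ' i + 1 := by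
      rcases Nat.lt_or_ge τ' S with h' | h'
      · exact h.step τ' h' i
      · left; rw [h.const τ' h', h.const (τ' + 1) (by omega)]
    push_cast
    omega

theorem IsWalk.strictMono {p δ S : ℕ} {e : Fin p → ℤ} {f : ℕ → Fin p → ℤ}
    (h : IsWalk p δ S e f) (τ : ℕ) : StrictMono (f τ) := by
  rcases Nat.le_total τ S with h' | h'
  · exact (h.admissible τ h').1
  · rw [h.const τ h', ← h.const S le_rfl]
    exact (h.admissible S le_rfl).1

/-- The length p + 1 keeps a chain strictly between the diagonals -a and b, so each of its boxes
belongs to a particle. By pigeonhole two share a particle, but along a particle's path rows weakly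
increase while columns weakly decrease. -/
theorem IsWalk.not_hasChain {p δ a b t : ℕ} {f : ℕ → Fin p → ℤ}
    (h : IsWalk p δ (a + b) (shifted p a) f) :
    ¬ HasChain (boxesOfWalk p a b t f) (p + 1) := by
  rintro ⟨u, h1, h2, hu⟩
  have hlabel : ∀ j, ∃ i, f ((b : ℤ) - (((u j).2 : ℤ) - (u j).1)).toNat i = ((u j).1 : ℤ) - 1 ∧
      ((u j).2 : ℤ) - (u j).1 ≤ b := by
    intro j
    have hj := mem_boxesOfWalk.1 (hu j)
    have e1 := h1.add_le_of_fin_nat (Fin.zero_le j)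
    have e2 := h2.add_le_of_fin_nat (Fin.zero_le j)
    have e3 := h1.add_le_of_fin_nat (Fin.le_last j)
    have e4 := h2.add_le_of_fin_nat (Fin.le_last j)
    have e5 := mem_truncatedRectangle.1 (mem_boxesOfWalk.1 (hu 0)).1
    have e6 := mem_truncatedRectangle.1 (mem_boxesOfWalk.1 (hu (Fin.last p))).1
    simp only [Fin.val_last, Fin.val_zero] at e1 e2 e3 e4
    rcases hj.2 with hj | hj | ⟨i, hi⟩
    · omega
    · omega
    · exact ⟨i, hi, by omega⟩
  choose g hg hg' using hlabel
  obtain ⟨j, j', hne, heq⟩ := Fintype.exists_ne_map_eq_of_card_lt g (by simp)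
  wlog hlt : j < j' generalizing j j'
  · exact this j' j hne.symm heq.symm (lt_of_le_of_ne (not_lt.1 hlt) hne.symm)
  have e1 := h1 hlt
  have e2 := h2 hlt
  have e3 := hg j
  have e4 := hg j'
  have e5 := hg' j
  have e6 := hg' j'
  rw [← heq] at e4
  dsimp only at e1 e2
  rcases Nat.le_total ((b : ℤ) - (((u j).2 : ℤ) - (u j).1)).toNat
    ((b : ℤ) - (((u j').2 : ℤ) - (u j').1)).toNat with hle | hle
  · have := h.le_and_le hle (g j)
    omega
  · have := h.le_and_le hle (g j)
    omega

theorem IsWalk.exists_mem_boxesOfWalk {p δ a b t : ℕ} (ha : a = t + δ) {f : ℕ → Fin p → ℤ}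
    (h : IsWalk p δ (a + b) (shifted p a) f) {τ : ℕ} (hτ : τ ≤ a + b) (i : Fin p) :
    ∃ q ∈ boxesOfWalk p a b t f, (q.1 : ℤ) = f τ i + 1 ∧ (q.2 : ℤ) = f τ i + 1 + b - τ := by
  have e1 := h.le_and_le (Nat.zero_le τ) i
  have e2 := h.le_and_le hτ i
  have e3 := (h.admissible τ hτ).2 i
  have hi := i.2
  rw [h.start] at e1
  rw [h.const _ le_rfl] at e2
  simp only [packed, shifted] at e1 e2
  push_cast at e1 e2 e3
  refine ⟨((f τ i + 1).toNat, (f τ i + 1 + b - τ).toNat), ?_, ?_, ?_⟩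
  · have f1 : ((f τ i + 1).toNat : ℤ) = f τ i + 1 := Int.toNat_of_nonneg (by omega)
    have f2 : ((f τ i + 1 + b - τ).toNat : ℤ) = f τ i + 1 + b - τ :=
      Int.toNat_of_nonneg (by omega)
    rw [mem_boxesOfWalk, mem_truncatedRectangle]
    refine ⟨?_, Or.inr (Or.inr ⟨i, ?_⟩)⟩
    · dsimp only
      omega
    · dsimp only
      rw [f1, f2, show ((b : ℤ) - (f τ i + 1 + b - τ - (f τ i + 1))).toNat = τ by omega]
      ring
  · exact Int.toNat_of_nonneg (by omega)
  · exact Int.toNat_of_nonneg (by omega)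

theorem IsWalk.card_diagonal {p δ a b t : ℕ} (ha : a = t + δ) (hab : a ≤ b) {f : ℕ → Fin p → ℤ}
    (h : IsWalk p δ (a + b) (shifted p a) f) (d : ℤ) :
    (diagonal (boxesOfWalk p a b t f) d).card =
      (diagonal (hook (a + p) (b + p) p) d).card := by
  by_cases hd : d ≤ -(a : ℤ) ∨ (b : ℤ) ≤ d
  · congr 1
    refine Finset.Subset.antisymm ?_ ?_
    · intro q hq
      rw [mem_diagonal, mem_boxesOfWalk] at hq
      exact diagonal_subset_hook hd (mem_diagonal.2 ⟨hq.1.1, hq.2⟩)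
    · intro q hq
      rw [mem_diagonal] at hq
      rw [mem_diagonal, mem_boxesOfWalk]
      refine ⟨⟨hook_subset_truncatedRectangle (by omega) (by omega) hq.1, ?_⟩, hq.2⟩
      omega
  · rw [card_diagonal_hook (by omega) (by omega)]
    refine le_antisymm (card_diagonal_le h.not_hasChain d) ?_
    have := fun i => h.exists_mem_boxesOfWalk (t := t) ha (τ := ((b : ℤ) - d).toNat)
      (by omega) i
    choose q hq hq1 hq2 using this
    have := Finset.card_le_card_of_injOn (s := Finset.univ)
      (t := diagonal (boxesOfWalk p a b t f) d) q ?_ ?_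
    · simpa using this
    · intro i _
      rw [Finset.mem_coe, mem_diagonal]
      refine ⟨hq i, ?_⟩
      rw [hq1, hq2]
      omega
    · intro i _ j _ hij
      apply (h.strictMono ((b : ℤ) - d).toNat).injective
      have e1 := hq1 i
      have e2 := hq1 j
      rw [hij] at e1
      omega

theorem IsWalk.eq_of_boxesOfWalk_eq {p δ a b t : ℕ} (ha : a = t + δ) {f g : ℕ → Fin p → ℤ}
    (hf : IsWalk p δ (a + b) (shifted p a) f) (hg : IsWalk p δ (a + b) (shifted p a) g)
    (h : boxesOfWalk p a b t f = boxesOfWalk p a b t g) : f = g := by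
  have key : ∀ {f g : ℕ → Fin p → ℤ} (_ : IsWalk p δ (a + b) (shifted p a) f)
      (_ : boxesOfWalk p a b t f = boxesOfWalk p a b t g) {τ : ℕ} (_ : 0 < τ) (_ : τ < a + b),
      Set.range (f τ) ⊆ Set.range (g τ) := by
    rintro f g hf h τ h0 hτ _ ⟨i, rfl⟩
    obtain ⟨q, hq, hq1, hq2⟩ := hf.exists_mem_boxesOfWalk (t := t) ha hτ.le i
    rw [h, mem_boxesOfWalk] at hq
    rcases hq.2 with hq | hq | ⟨j, hj⟩
    · omega
    · omega
    · rw [show ((b : ℤ) - ((q.2 : ℤ) - q.1)).toNat = τ by omega] at hj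
      exact ⟨j, by omega⟩
  funext τ
  rcases Nat.lt_or_ge τ (a + b) with hτ | hτ
  · rcases Nat.eq_zero_or_pos τ with rfl | h0
    · rw [hf.start, hg.start]
    · exact ((hf.strictMono τ).range_inj (hg.strictMono τ)).1
        ((key hf h h0 hτ).antisymm (key hg h.symm h0 hτ))
  · rw [hf.const τ hτ, hg.const τ hτ]

theorem exists_isWalk {p δ a b t : ℕ} (ha : a = t + δ) (hab : a ≤ b) {A : Finset (ℕ × ℕ)}
    (hAR : A ⊆ truncatedRectangle (a + p) (b + p) t) (hA : ¬ HasChain A (p + 1))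
    (hcard : ∀ d, (diagonal A d).card = (diagonal (hook (a + p) (b + p) p) d).card) :
    ∃ f, IsWalk p δ (a + b) (shifted p a) f ∧ boxesOfWalk p a b t f = A := by
  have hfull : ∀ q ∈ truncatedRectangle (a + p) (b + p) t,
      ((q.2 : ℤ) - q.1 ≤ -a ∨ (b : ℤ) ≤ (q.2 : ℤ) - q.1) → q ∈ A := by
    intro q hq hd
    have h1 : diagonal A ((q.2 : ℤ) - q.1) ⊆ diagonal (hook (a + p) (b + p) p) _ :=
      (Finset.filter_subset_filter _ hAR).trans (diagonal_subset_hook hd)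
    have h2 := Finset.eq_of_subset_of_card_le h1 (hcard _).ge
    have h3 := diagonal_subset_hook hd (mem_diagonal.2 ⟨hq, rfl⟩)
    rw [← h2, mem_diagonal] at h3
    exact h3.1
  -- Capping the time at a + b makes the walk constant afterwards.
  have hx : ∀ τ : ℕ, ∃ x : Fin p → ℤ, StrictMono x ∧ ∀ z, (∃ i, x i = z) ↔
      ∃ q ∈ A, (q.1 : ℤ) = z + 1 ∧ (q.2 : ℤ) = z + 1 + b - (min τ (a + b) : ℕ) := by
    intro τ
    set d : ℤ := b - (min τ (a + b) : ℕ) with hd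
    set s := (diagonal A d).image fun q => (q.1 : ℤ) - 1 with hs
    have hsc : s.card = p := by
      rw [hs, Finset.card_image_of_injOn, hcard, card_diagonal_hook (by omega) (by omega)]
      intro q hq q' hq' h
      rw [Finset.mem_coe, mem_diagonal] at hq hq'
      dsimp only at h
      exact Prod.ext (by omega) (by omega)
    refine ⟨s.orderEmbOfFin hsc, (s.orderEmbOfFin hsc).strictMono, fun z => ?_⟩
    rw [← Set.mem_range, Finset.range_orderEmbOfFin, Finset.mem_coe, hs, Finset.mem_image]
    constructor
    · rintro ⟨q, hq, rfl⟩
      rw [mem_diagonal] at hq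
      exact ⟨q, hq.1, by omega, by omega⟩
    · rintro ⟨q, hq, h1, h2⟩
      exact ⟨q, mem_diagonal.2 ⟨hq, by omega⟩, by omega⟩
  choose f hmono hf using hx
  have hbox : ∀ τ i, ∃ q ∈ A, (q.1 : ℤ) = f τ i + 1 ∧
      (q.2 : ℤ) = f τ i + 1 + b - (min τ (a + b) : ℕ) := fun τ i => (hf τ _).1 ⟨i, rfl⟩
  have hend : ∀ τ, a + b ≤ τ → f τ = shifted p a := by
    intro τ hτ
    refine ((hmono τ).range_inj fun i j h => by simpa [shifted] using h).1 (Set.ext fun z => ?_)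
    rw [Set.mem_range, hf, min_eq_right hτ]
    constructor
    · rintro ⟨q, hq, h1, h2⟩
      have := mem_truncatedRectangle.1 (hAR hq)
      exact ⟨⟨(z - a).toNat, by omega⟩, by simp only [shifted]; omega⟩
    · rintro ⟨i, rfl⟩
      have := i.2
      refine ⟨((i : ℕ) + a + 1, (i : ℕ) + 1), hfull _ ?_ ?_, ?_, ?_⟩
      · rw [mem_truncatedRectangle]
        dsimp only
        omega
      all_goals simp only [shifted]; push_cast; omega
  refine ⟨f, ⟨?_, fun τ hτ => ⟨hmono τ, fun i => ?_⟩, fun τ hτ i => ?_, hend⟩, ?_⟩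
  · refine ((hmono 0).range_inj fun i j h => by simpa [packed] using h).1 (Set.ext fun z => ?_)
    rw [Set.mem_range, hf, min_eq_left (Nat.zero_le _)]
    constructor
    · rintro ⟨q, hq, h1, h2⟩
      have := mem_truncatedRectangle.1 (hAR hq)
      exact ⟨⟨z.toNat, by omega⟩, by simp only [packed]; omega⟩
    · rintro ⟨i, rfl⟩
      have := i.2
      refine ⟨((i : ℕ) + 1, (i : ℕ) + b + 1), hfull _ ?_ ?_, ?_, ?_⟩
      · rw [mem_truncatedRectangle]
        dsimp only
        omega
      all_goals simp only [packed]; push_cast; omega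
  -- With row x + 1 and column x + 1 + b - τ, the staircase condition reads 2x + 2 ≤ 2p + τ + δ,
  -- because a = t + δ.
  · obtain ⟨q, hq, h1, h2⟩ := hbox τ i
    have := mem_truncatedRectangle.1 (hAR hq)
    rw [min_eq_left hτ] at h2
    push_cast
    omega
  · choose u hu hu1 hu2 using hbox (τ + 1)
    choose v hv hv1 hv2 using hbox τ
    rw [min_eq_left (show τ + 1 ≤ a + b by omega)] at hu2
    rw [min_eq_left hτ.le] at hv2
    push_cast at hu2
    have mu1 : StrictMono fun i => (u i).1 := fun i j hij => by
      have := hmono (τ + 1) hij; have := hu1 i; have := hu1 j; dsimp only; omega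
    have mu2 : StrictMono fun i => (u i).2 := fun i j hij => by
      have := hmono (τ + 1) hij; have := hu2 i; have := hu2 j; dsimp only; omega
    have mv1 : StrictMono fun i => (v i).1 := fun i j hij => by
      have := hmono τ hij; have := hv1 i; have := hv1 j; dsimp only; omega
    have mv2 : StrictMono fun i => (v i).2 := fun i j hij => by
      have := hmono τ hij; have := hv2 i; have := hv2 j; dsimp only; omega
    have e1 := hu1 i
    have e2 := hu2 i
    have e3 := hv1 i
    have e4 := hv2 i
    by_contra hne
    -- A move by a negative amount, or by at least 2, puts the i-th boxes of the two diagonals in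
    -- strict south-east position, and splicing yields a chain of length p + 1.
    rcases lt_or_ge (f (τ + 1) i) (f τ i) with hlt | hge
    · exact hA (hasChain_splice mu1 mu2 mv1 mv2 hu hv i (by omega) (by omega))
    · exact hA (hasChain_splice mv1 mv2 mu1 mu2 hv hu i (by omega) (by omega))
  · ext q
    rw [mem_boxesOfWalk]
    constructor
    · rintro ⟨hqR, hq⟩
      by_cases hd : (q.2 : ℤ) - q.1 ≤ -a ∨ (b : ℤ) ≤ (q.2 : ℤ) - q.1
      · exact hfull q hqR hd
      · obtain ⟨q', hq', h1, h2⟩ := (hf _ _).1 ((or_assoc.2 hq).resolve_left hd)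
        rw [min_eq_left (by omega)] at h2
        obtain rfl : q = q' := Prod.ext (by omega) (by omega)
        exact hq'
    · intro hq
      refine ⟨hAR hq, ?_⟩
      by_cases hd : (q.2 : ℤ) - q.1 ≤ -a ∨ (b : ℤ) ≤ (q.2 : ℤ) - q.1
      · exact or_assoc.1 (Or.inl hd)
      · refine Or.inr (Or.inr ((hf _ _).2 ⟨q, hq, by ring, ?_⟩))
        rw [min_eq_left (by omega)]
        omega

/-! ### From sets of boxes to fillings, and the product formula -/

/-- The boxes filled with `1`. -/
def Filling.support {R : Finset (ℕ × ℕ)} (F : Filling R) : Finset (ℕ × ℕ) :=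
  (Finset.univ.filter fun b => F b = 1).map (Function.Embedding.subtype _)

theorem Filling.mem_support {R : Finset (ℕ × ℕ)} {F : Filling R} {q : ℕ × ℕ} :
    q ∈ F.support ↔ ∃ h : q ∈ R, F ⟨q, h⟩ = 1 := by
  simp [Filling.support]

theorem Filling.support_subset {R : Finset (ℕ × ℕ)} (F : Filling R) : F.support ⊆ R :=
  fun _ hq => (Filling.mem_support.1 hq).1

theorem Filling.card_support {R : Finset (ℕ × ℕ)} (F : Filling R) : F.support.card = F.ones :=
  Finset.card_map _

theorem Filling.support_injective {R : Finset (ℕ × ℕ)} :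
    Function.Injective (Filling.support (R := R)) := by
  intro F G h
  funext ⟨q, hq⟩
  have h1 : F ⟨q, hq⟩ = 1 ↔ G ⟨q, hq⟩ = 1 := by
    have := Finset.ext_iff.1 h q
    simpa [Filling.mem_support, hq] using this
  omega

theorem Filling.exists_support_eq {R A : Finset (ℕ × ℕ)} (h : A ⊆ R) :
    ∃ F : Filling R, F.support = A := by
  refine ⟨fun b => if b.1 ∈ A then 1 else 0, Finset.ext fun q => ?_⟩
  rw [Filling.mem_support]
  constructor
  · rintro ⟨hq, h1⟩
    by_contra hqA
    simp [hqA] at h1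
  · intro hq
    exact ⟨h hq, by simp [hq]⟩

theorem Filling.containsId_iff {m n t k : ℕ} (F : Filling (truncatedRectangle m n t)) :
    F.ContainsId (k + 1) ↔ HasChain F.support (k + 1) := by
  constructor
  · rintro ⟨r, c, hr, hc, hR, h⟩
    exact ⟨fun i => (r i, c i), hr, hc, fun i => Filling.mem_support.2 ⟨hR i i, h i⟩⟩
  · rintro ⟨u, h1, h2, hu⟩
    refine ⟨fun i => (u i).1, fun i => (u i).2, h1, h2, fun i j => ?_, fun i => ?_⟩
    · have e1 := mem_truncatedRectangle.1 (F.support_subset (hu i))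
      have e2 := mem_truncatedRectangle.1 (F.support_subset (hu j))
      -- Every crossing box lies weakly above and to the left of the last box of the chain, hence in
      -- the region.
      have e3 := mem_truncatedRectangle.1 (F.support_subset (hu (Fin.last k)))
      have e4 := h1.monotone (Fin.le_last i)
      have e5 := h2.monotone (Fin.le_last j)
      rw [mem_truncatedRectangle]
      dsimp only at e4 e5 ⊢
      omega
    · exact (Filling.mem_support.1 (hu i)).2

theorem admissible_shifted {p δ a b : ℕ} (hab : a ≤ b) :
    Admissible p (a + b + δ) (shifted p a) := by
  refine ⟨fun i j h => by simpa [shifted] using h, fun i => ?_⟩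
  have := i.2
  simp only [shifted]
  push_cast
  omega

theorem ncard_maximalAvoidingFillings {p δ a b t : ℕ} (ha : a = t + δ) (hab : a ≤ b) :
    (maximalAvoidingFillings (truncatedRectangle (a + p) (b + p) t) (p + 1)).ncard =
      (walks p δ (a + b) (shifted p a)).card := by
  classical
  have hadm := admissible_shifted (p := p) (δ := δ) hab
  rw [← Set.ncard_image_of_injective _ Filling.support_injective,
    ← Finset.card_image_of_injOn (f := boxesOfWalk p a b t), ← Set.ncard_coe_finset]
  · congr 1
    ext A
    simp only [Set.mem_image, Finset.coe_image, Finset.mem_coe, mem_walks _ _ _ _ hadm]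
    constructor
    · rintro ⟨F, ⟨hF, hmax⟩, rfl⟩
      rw [Filling.AvoidsId, Filling.containsId_iff] at hF
      refine exists_isWalk ha hab F.support_subset hF
        ((maximal_iff_card_diagonal (by omega) (by omega) F.support_subset hF).1 ?_)
      intro B hBR hB
      obtain ⟨G, rfl⟩ := Filling.exists_support_eq hBR
      rw [Filling.card_support, Filling.card_support]
      exact hmax G (by rwa [Filling.AvoidsId, Filling.containsId_iff])
    · rintro ⟨f, hf, rfl⟩
      obtain ⟨F, hF⟩ := Filling.exists_support_eq
        (show boxesOfWalk p a b t f ⊆ truncatedRectangle (a + p) (b + p) t from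
          fun q hq => (mem_boxesOfWalk.1 hq).1)
      have hchain : ¬ HasChain F.support (p + 1) := hF ▸ hf.not_hasChain
      refine ⟨F, ⟨by rwa [Filling.AvoidsId, Filling.containsId_iff], fun G hG => ?_⟩, hF⟩
      rw [Filling.AvoidsId, Filling.containsId_iff] at hG
      rw [← Filling.card_support, ← Filling.card_support]
      refine (maximal_iff_card_diagonal (by omega) (by omega) F.support_subset hchain).2 ?_
        _ G.support_subset hG
      rw [hF]
      exact hf.card_diagonal ha hab
  · intro f hf g hg h
    rw [Finset.mem_coe, mem_walks _ _ _ _ hadm] at hf hg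
    exact hf.eq_of_boxesOfWalk_eq ha hg h

theorem ncard_maximalAvoidingFillings_eq_prod {p δ a b t : ℕ} (hδ : δ ≤ 1) (ha : a = t + δ)
    (hab : a ≤ b) :
    ((maximalAvoidingFillings (truncatedRectangle (a + p) (b + p) t) (p + 1)).ncard : ℚ) =
      (∏ i ∈ Finset.Icc 1 p, ((a + (b + δ) + 2 * i - 2).factorial : ℚ) /
        ((a + p - i).factorial * (b + δ + p + i - 1).factorial)) *
      (∏ i ∈ Finset.Icc 1 (p - 1), (i.factorial : ℚ)) *
      ∏ i ∈ Finset.Icc 1 p, ∏ j ∈ Finset.Icc i p, (((b + δ : ℕ) : ℚ) - a + i + j - 1) := by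
  have hadm := admissible_shifted (p := p) (δ := δ) hab
  -- The clock starts at δ, so the determinant is taken at time a + (b + δ): the evaluation applies
  -- with b + δ in place of b.
  rw [← det_ballotMatrix_shifted_eq_prod, ncard_maximalAvoidingFillings ha hab, ← add_assoc]
  exact_mod_cast congrArg (Int.cast (R := ℚ)) (card_walks p δ hδ (a + b) (shifted p a) hadm)

theorem theorem3 (m n k t : ℕ) (hk : 2 ≤ k) (hkm : k ≤ m) (hmn : m ≤ n)
    (ht : t = m - k ∨ t = m - k + 1) :
    ((maximalAvoidingFillings (truncatedRectangle m n t) k).ncard : ℚ) =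
      (∏ i ∈ Finset.Icc 1 (k - 1),
        ((m + n - 2 * k + 2 * i + kroneckerDelta t (m - k)).factorial : ℚ) /
          (((m - i).factorial : ℚ) *
            ((n + i - 1 + kroneckerDelta t (m - k)).factorial : ℚ))) *
      (∏ i ∈ Finset.Icc 1 (k - 2), (i.factorial : ℚ)) *
      (∏ i ∈ Finset.Icc 1 (k - 1), ∏ j ∈ Finset.Icc i (k - 1),
        ((n : ℚ) - (m : ℚ) + (i : ℚ) + (j : ℚ) - 1 + (kroneckerDelta t (m - k) : ℚ))) := by
  obtain ⟨p, rfl⟩ := Nat.exists_eq_add_of_le' (show 1 ≤ k by omega)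
  obtain ⟨a, rfl⟩ := Nat.exists_eq_add_of_le' (show p ≤ m by omega)
  obtain ⟨b, rfl⟩ := Nat.exists_eq_add_of_le' (show p ≤ n by omega)
  set δ := kroneckerDelta t (a + p - (p + 1)) with hδ
  have h : δ ≤ 1 ∧ a = t + δ := by
    rw [kroneckerDelta] at hδ
    split_ifs at hδ <;> omega
  rw [ncard_maximalAvoidingFillings_eq_prod h.1 h.2 (by omega)]
  simp only [show p + 1 - 1 = p by omega, show p + 1 - 2 = p - 1 by omega]
  congr 1
  · congr 1
    refine Finset.prod_congr rfl fun i hi => ?_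
    rw [Finset.mem_Icc] at hi
    congr 3
    · omega
    · congr 1; omega
  · refine Finset.prod_congr rfl fun i _ => Finset.prod_congr rfl fun j _ => ?_
    push_cast
    ring
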